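/- Let $a<b$, $L>0$, $\gamma>0$, $s>0$, $d\in\mathbb N=\{1,2,\dots\}$, and let $\mathbb T$ be the circle represented by $[a,b]$ with identified end points. Let $L_2(\mathbb T)$ be the Hilbert space of complex-valued square-integrable functions on $\mathbb T$ with scalar product $\langle f,g\rangle=\frac1L\int_{\mathbb T} f\,\overline g\,dx$, with orthonormal basis $b_k(x)=\sqrt{\tfrac{L}{b-a}}\,\exp\!\big(2\pi i k\,\tfrac{x-a}{b-a}\big)$, $k\in\mathbb Z$; let $L_2(\mathbb T^d)$ be its $d$-th tensor power, with scalar product $L^{-d}\int_{\mathbb T^d} f\,\overline g\,dx$ and orthonormal basis $b_{k}(x)=\prod_{j=1}^d b_{k_j}(x_j)$, $k\in\mathbb Z^d$. For $k\in\mathbb Z$ put $t_k=\big|\gamma^{-1}\tfrac{2\pi k}{b-a}\big|$ and $$w_k^{\circ}=\Big(\sum_{l=0}^s t_k^{2l}\Big)^{1/2},\quad w_k^{*}=\big(1+t_k^{2s}\big)^{1/2},\quad w_k^{+}=\big(1+t_k^{2}\big)^{s/2},\quad w_k^{\#}=\big(1+t_k\big)^{s}.$$ For $\square\in\{\circ,*,+,\#\}$,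 where in the case $\square=\circ$ the number $s$ is assumed to be an integer, let $H^{s,\square,\gamma}_{\rm mix}(\mathbb T^d)$ be the Hilbert space of all $f\in L_2(\mathbb T^d)$ with $$\|f\|^2=\sum_{k\in\mathbb Z^d}\Big(\prod_{j=1}^d w^{\square}_{k_j}\Big)^2\,|\langle f,b_k\rangle|^2<\infty$$ (the $d$-th tensor power of the univariate space with weights $w^\square_k$). For a bounded linear operator $T:X\to Y$ between Hilbert spaces let $a_n(T)=\inf\{\|T-A\| : A:X\to Y \text{ bounded and linear},\ \operatorname{rank}A<n\}$, and let $$a_n=a_n\big(H^{s,\square,\gamma}_{\rm mix}(\mathbb T^d)\hookrightarrow L_2(\mathbb T^d)\big).$$ Put $\eta=\frac{2\pi}{\gamma(b-a)}$ and, for $\delta\in(0,1]$, $\tilde C(\delta)=\exp\big((3/\eta)^{1+\delta}/\delta\big)$. Write $S=\sum_{l=0}^s\eta^{2l}$ and define $$\begin{array}{c|c|c|c} \square & \sigma_\square(2) & \alpha_\square(d,\delta) & \beta_\square(d,n)\\ \hline \circ & S^{-1/2} & \dfrac{\frac12\log S}{\log d+\frac{1+\delta}{2s}\log S} & \dfrac{\frac12\log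 S}{\log\left(1+\frac{2}{\log_3 n}d\right)}\\ * & (1+\eta^{2s})^{-1/2} & \dfrac{\frac12\log(1+\eta^{2s})}{\log d+\frac{1+\delta}{2s}\log(1+\eta^{2s})} & \dfrac{\frac12\log(1+\eta^{2s})}{\log\left(1+\frac{2}{\log_3 n}d\right)}\\ + & (1+\eta^{2})^{-s/2} & \dfrac{\frac s2\log(1+\eta^{2})}{\log d+\frac{1+\delta}{2}\log(1+\eta^{2})} & \dfrac{\frac s2\log(1+\eta^{2})}{\log\left(1+\frac{2}{\log_3 n}d\right)}\\ \# & (1+\eta)^{-s} & \dfrac{s\log(1+\eta)}{\log d+(1+\delta)\log(1+\eta)} & \dfrac{s\log(1+\eta)}{\log\left(1+\frac{2}{\log_3 n}d\right)} \end{array}$$ Then $$\sigma_\square(2)\,\Big(\frac1n\Big)^{\beta_\square(d,n)}\le a_n\quad\text{for all } n\in\{2,\dots,3^d\},$$ and, for every $\delta\in(0,1]$, $$a_n\le\Big(\frac{\tilde C(\delta)}{n}\Big)^{\alpha_\square(d,\delta)}\quad\text{for all } n\in\mathbb N.$$ -/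

import Mathlib

open MeasureTheory
open scoped ENNReal InnerProductSpace ComplexConjugate

noncomputable section

namespace TorusApprox

/-! ### Approximation numbers -/

/-- The `n`-th approximation number `a_n(T) = inf { ‖T - A‖ : A bounded linear, rank A < n }`. -/
def approxNumber {X Y : Type*} [NormedAddCommGroup X] [NormedSpace ℂ X]
    [NormedAddCommGroup Y] [NormedSpace ℂ Y] (n : ℕ) (T : X →L[ℂ] Y) : ℝ :=
  sInf {r : ℝ | ∃ A : X →L[ℂ] Y, LinearMap.rank (A : X →ₗ[ℂ] Y) < (n : Cardinal) ∧ r = ‖T - A‖}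

/-! ### Weighted subspaces of a Hilbert space with a fixed orthonormal basis -/

section Weighted

variable {ι Y : Type*} [NormedAddCommGroup Y] [InnerProductSpace ℂ Y]

/-- Real weights bounded below by one. -/
structure Weight (ι : Type*) where
  toFun : ι → ℝ
  one_le : ∀ i, 1 ≤ toFun i

/-- Elements of `Y` whose coefficients `c_i` in the basis `B` satisfy `∑ v_i² |c_i|² < ∞`. -/
def weightedSubmodule (B : HilbertBasis ι ℂ Y) (v : Weight ι) : Submodule ℂ Y where
  carrier := {f | Memℓp (fun i => (v.toFun i : ℂ) * B.repr f i) 2}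
  zero_mem' := by
    have : Memℓp (fun _ : ι => (0 : ℂ)) 2 := zero_memℓp
    simpa using this
  add_mem' := by
    intro f g hf hg
    have := Memℓp.add hf hg
    simp only [Set.mem_ofPred_eq, map_add, lp.coeFn_add, Pi.add_apply, mul_add]
    exact this
  smul_mem' := by
    intro c f hf
    have := Memℓp.const_smul hf c
    simp only [Set.mem_ofPred_eq, map_smul, lp.coeFn_smul, Pi.smul_apply, smul_eq_mul]
    convert this using 1
    funext i
    simp only [Pi.smul_apply, smul_eq_mul]
    ring

/-- `weightedSubmodule B v` as a type of its own; it carries the weighted inner product below,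
not the one of `Y`. -/
def WeightedSpace (B : HilbertBasis ι ℂ Y) (v : Weight ι) : Type _ := weightedSubmodule B v

namespace WeightedSpace

variable (B : HilbertBasis ι ℂ Y) (v : Weight ι)

instance : AddCommGroup (WeightedSpace B v) := inferInstanceAs (AddCommGroup (weightedSubmodule B v))
instance : Module ℂ (WeightedSpace B v) := inferInstanceAs (Module ℂ (weightedSubmodule B v))

/-- The inclusion into `Y`, as a linear map. -/
def incl : WeightedSpace B v →ₗ[ℂ] Y := (weightedSubmodule B v).subtype

/-- The weighted coefficients `(v_i c_i)_i` of an element, as a square summable family. -/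
def coeff : WeightedSpace B v →ₗ[ℂ] lp (fun _ : ι => ℂ) 2 where
  toFun f := ⟨fun i => (v.toFun i : ℂ) * B.repr (incl B v f) i, f.2⟩
  map_add' f g := by
    ext i
    change (v.toFun i : ℂ) * B.repr (incl B v (f + g)) i = (v.toFun i : ℂ) * B.repr (incl B v f) i +
      (v.toFun i : ℂ) * B.repr (incl B v g) i
    rw [map_add, map_add, lp.coeFn_add, Pi.add_apply, mul_add]
  map_smul' c f := by
    ext i
    simp only [map_smul, lp.coeFn_smul, Pi.smul_apply, smul_eq_mul, RingHom.id_apply]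
    ring

theorem coeff_apply (f : WeightedSpace B v) (i : ι) :
    coeff B v f i = (v.toFun i : ℂ) * B.repr (incl B v f) i := rfl

theorem weight_ne_zero (i : ι) : (v.toFun i : ℂ) ≠ 0 := by
  have := v.one_le i
  exact_mod_cast (by linarith : (0 : ℝ) < v.toFun i).ne'

theorem coeff_injective : Function.Injective (coeff B v) := by
  intro f g h
  apply Subtype.ext
  apply B.repr.injective
  ext i
  have h1 := congrArg (fun c : lp (fun _ : ι => ℂ) 2 => c i) h
  simp only [coeff_apply] at h1
  exact mul_left_cancel₀ (weight_ne_zero v i) h1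

theorem coeff_surjective : Function.Surjective (coeff B v) := by
  intro c
  have hc : Memℓp (fun i => (v.toFun i : ℂ)⁻¹ * c i) 2 := by
    refine Memℓp.mono' (lp.memℓp c) ?_
    intro i
    rw [norm_mul, norm_inv, Complex.norm_real, Real.norm_eq_abs]
    have h1 := v.one_le i
    have h2 : |v.toFun i|⁻¹ ≤ 1 := inv_le_one_of_one_le₀ (h1.trans (le_abs_self _))
    calc |v.toFun i|⁻¹ * ‖c i‖ ≤ 1 * ‖c i‖ := by gcongr
      _ = ‖c i‖ := one_mul _
  have key : (fun i => (v.toFun i : ℂ) * B.repr (B.repr.symm ⟨_, hc⟩) i) = c := by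
    funext i
    rw [LinearIsometryEquiv.apply_symm_apply]
    change (v.toFun i : ℂ) * ((v.toFun i : ℂ)⁻¹ * c i) = c i
    rw [mul_inv_cancel_left₀ (weight_ne_zero v i)]
  refine ⟨⟨B.repr.symm ⟨_, hc⟩, ?_⟩, ?_⟩
  · change Memℓp (fun i => (v.toFun i : ℂ) * B.repr (B.repr.symm ⟨_, hc⟩) i) 2
    rw [key]
    exact lp.memℓp c
  · ext i
    exact congrFun key i

instance : NormedAddCommGroup (WeightedSpace B v) :=
  NormedAddCommGroup.induced _ _ (coeff B v) (coeff_injective B v)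

theorem norm_eq (f : WeightedSpace B v) : ‖f‖ = ‖coeff B v f‖ := rfl

/-- The weighted inner product `∑ v_i² conj (c_i f) c_i g`. -/
instance : InnerProductSpace ℂ (WeightedSpace B v) where
  norm_smul_le c f := by
    rw [norm_eq, norm_eq, map_smul, norm_smul]
  inner f g := ⟪coeff B v f, coeff B v g⟫_ℂ
  norm_sq_eq_re_inner f := norm_sq_eq_re_inner (𝕜 := ℂ) (coeff B v f)
  conj_inner_symm f g := inner_conj_symm _ _
  add_left f g h := by rw [map_add, inner_add_left]
  smul_left f g c := by rw [map_smul, inner_smul_left]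

theorem inner_eq (f g : WeightedSpace B v) : ⟪f, g⟫_ℂ = ⟪coeff B v f, coeff B v g⟫_ℂ := rfl

/-- The weighted coefficients identify the weighted space with `ℓ²`. -/
def coeffEquiv : WeightedSpace B v ≃ₗᵢ[ℂ] lp (fun _ : ι => ℂ) 2 where
  toLinearEquiv := LinearEquiv.ofBijective (coeff B v) ⟨coeff_injective B v, coeff_surjective B v⟩
  norm_map' _ := rfl

instance : CompleteSpace (WeightedSpace B v) :=
  (coeffEquiv B v).toIsometryEquiv.completeSpace

theorem norm_incl_le (f : WeightedSpace B v) : ‖incl B v f‖ ≤ 1 * ‖f‖ := by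
  rw [one_mul, norm_eq, ← B.repr.norm_map (incl B v f)]
  have h2 : (0 : ℝ) < (2 : ℝ≥0∞).toReal := by norm_num
  refine lp.norm_le_of_forall_sum_le h2 (norm_nonneg _) ?_
  intro t
  refine le_trans ?_ (lp.sum_rpow_le_norm_rpow h2 (coeff B v f) t)
  refine Finset.sum_le_sum fun i _ => ?_
  refine Real.rpow_le_rpow (norm_nonneg _) ?_ h2.le
  rw [coeff_apply, norm_mul, Complex.norm_real, Real.norm_eq_abs]
  exact le_mul_of_one_le_left (norm_nonneg _) ((v.one_le i).trans (le_abs_self _))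

/-- The embedding of the weighted space into `Y`. -/
def embedding : WeightedSpace B v →L[ℂ] Y := (incl B v).mkContinuous 1 (norm_incl_le B v)

end WeightedSpace

end Weighted

/-! ### The torus and its Fourier basis -/

/-- The circle is represented by the interval `[a, b]` with identified end points; `L` is the
normalisation constant in the scalar product `(1/L) ∫ f ḡ`. -/
structure TorusModel where
  a : ℝ
  b : ℝ
  L : ℝ
  a_lt_b : a < b
  L_pos : 0 < L

namespace TorusModel

variable (P : TorusModel)

/-- The circle, as the quotient `ℝ / (b - a)ℤ`. -/
abbrev Circle : Type := AddCircle (P.b - P.a)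

instance : Fact (0 < P.b - P.a) := ⟨sub_pos.2 P.a_lt_b⟩

/-- Lebesgue measure (of total mass `b - a`) divided by `L`. -/
def circleMeasure : Measure P.Circle := ENNReal.ofReal P.L⁻¹ • (volume : Measure P.Circle)

instance : IsFiniteMeasure P.circleMeasure := by
  unfold circleMeasure
  exact Measure.smul_finite _ ENNReal.ofReal_ne_top

/-- The product measure on the `d`-torus. -/
def torusMeasure (d : ℕ) : Measure (Fin d → P.Circle) := Measure.pi fun _ => P.circleMeasure

instance (d : ℕ) : IsFiniteMeasure (P.torusMeasure d) := by
  unfold torusMeasure; infer_instance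

/-- `L₂(𝕋)`. -/
abbrev L2 : Type := Lp ℂ 2 P.circleMeasure

/-- `L₂(𝕋^d)`. -/
abbrev L2Torus (d : ℕ) : Type := Lp ℂ 2 (P.torusMeasure d)

/-- The function `b_k(x) = √(L/(b-a)) exp(2πik (x-a)/(b-a))` on the circle. -/
def fourierFun (k : ℤ) : C(P.Circle, ℂ) where
  toFun x := (Real.sqrt (P.L / (P.b - P.a)) : ℂ) * fourier k (x - ((P.a : ℝ) : P.Circle))
  continuous_toFun := by fun_prop

/-- The function `b_k(x) = b_{k_1}(x_1) ⋯ b_{k_d}(x_d)` on the `d`-torus. -/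
def fourierFunTorus {d : ℕ} (k : Fin d → ℤ) : C(Fin d → P.Circle, ℂ) where
  toFun x := ∏ j, P.fourierFun (k j) (x j)
  continuous_toFun := by fun_prop

theorem fourierFun_apply_coe (k : ℤ) (x : ℝ) :
    P.fourierFun k (x : P.Circle) = (Real.sqrt (P.L / (P.b - P.a)) : ℂ) *
      Complex.exp (2 * Real.pi * Complex.I * k * ((x - P.a) / (P.b - P.a))) := by
  change _ * fourier k ((x : P.Circle) - ((P.a : ℝ) : P.Circle)) = _
  rw [← AddCircle.coe_sub, fourier_coe_apply]
  push_cast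
  rw [mul_div_assoc]

/-- `b_k` is a constant multiple of the monomial `fourier k`. -/
theorem fourierFun_eq (k : ℤ) (x : P.Circle) :
    P.fourierFun k x = ((Real.sqrt (P.L / (P.b - P.a)) : ℂ) *
      fourier k (-((P.a : ℝ) : P.Circle))) * fourier k x := by
  change _ * fourier k (x - ((P.a : ℝ) : P.Circle)) = _
  rw [sub_eq_add_neg x, fourier_apply, smul_add, AddCircle.toCircle_add]
  simp only [fourier_apply, _root_.Circle.coe_mul]
  ring

theorem sqrt_ne_zero : (Real.sqrt (P.L / (P.b - P.a)) : ℂ) ≠ 0 := by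
  have := div_pos P.L_pos (sub_pos.2 P.a_lt_b)
  exact_mod_cast (Real.sqrt_pos.2 this).ne'

theorem integral_fourierFun (k l : ℤ) :
    ∫ x, conj (P.fourierFun k x) * P.fourierFun l x ∂P.circleMeasure = if k = l then 1 else 0 := by
  have h0 : (0 : ℝ) < P.b - P.a := sub_pos.2 P.a_lt_b
  have hL := P.L_pos
  have horth := orthonormal_iff_ite.1 (orthonormal_fourier (T := P.b - P.a)) k l
  rw [ContinuousMap.inner_toLp] at horth
  have hk : ∀ x : P.Circle, conj (P.fourierFun k x) * P.fourierFun l x =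
      ((P.L / (P.b - P.a) : ℝ) : ℂ) * (conj (fourier k (-((P.a : ℝ) : P.Circle))) *
        fourier l (-((P.a : ℝ) : P.Circle))) * (fourier l x * conj (fourier k x)) := by
    intro x
    have hsq : ((P.L / (P.b - P.a) : ℝ) : ℂ) =
        (Real.sqrt (P.L / (P.b - P.a)) : ℂ) * (Real.sqrt (P.L / (P.b - P.a)) : ℂ) := by
      rw [← Complex.ofReal_mul, Real.mul_self_sqrt (div_pos hL h0).le]
    rw [fourierFun_eq, fourierFun_eq, map_mul, map_mul, Complex.conj_ofReal, hsq]
    ring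
  simp_rw [hk]
  rw [integral_const_mul, circleMeasure, integral_smul_measure,
    AddCircle.volume_eq_smul_haarAddCircle, integral_smul_measure, horth]
  split_ifs with h
  · subst h
    have h1 : conj (fourier k (-((P.a : ℝ) : P.Circle))) * fourier k (-((P.a : ℝ) : P.Circle))
        = 1 := by
      rw [fourier_apply, ← Complex.normSq_eq_conj_mul_self, _root_.Circle.normSq_coe]
      simp
    rw [h1, ENNReal.toReal_ofReal (inv_pos.2 hL).le, ENNReal.toReal_ofReal h0.le]
    simp only [Complex.real_smul]
    have h2 : (P.L : ℂ) ≠ 0 := by exact_mod_cast hL.ne'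
    have h3 : (P.b - P.a : ℂ) ≠ 0 := by exact_mod_cast h0.ne'
    push_cast
    field_simp
  · simp

theorem orthonormal_fourierFun :
    Orthonormal ℂ fun k => ContinuousMap.toLp (E := ℂ) 2 P.circleMeasure ℂ (P.fourierFun k) := by
  rw [orthonormal_iff_ite]
  intro k l
  rw [ContinuousMap.inner_toLp, ← P.integral_fourierFun k l]
  exact integral_congr_ae (Filter.Eventually.of_forall fun x => mul_comm _ _)

theorem orthonormal_fourierFunTorus (d : ℕ) :
    Orthonormal ℂ fun k : Fin d → ℤ =>
      ContinuousMap.toLp (E := ℂ) 2 (P.torusMeasure d) ℂ (P.fourierFunTorus k) := by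
  classical
  rw [orthonormal_iff_ite]
  intro k l
  rw [ContinuousMap.inner_toLp]
  have : ∀ x : Fin d → P.Circle, P.fourierFunTorus l x * conj (P.fourierFunTorus k x) =
      ∏ j, (conj (P.fourierFun (k j) (x j)) * P.fourierFun (l j) (x j)) := by
    intro x
    change (∏ j, P.fourierFun (l j) (x j)) * conj (∏ j, P.fourierFun (k j) (x j)) = _
    rw [map_prod, ← Finset.prod_mul_distrib]
    exact Finset.prod_congr rfl fun j _ => mul_comm _ _
  simp_rw [this]
  rw [torusMeasure, integral_fintype_prod_eq_prod (ι := Fin d)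
    (f := fun j y => conj (P.fourierFun (k j) y) * P.fourierFun (l j) y)]
  simp_rw [integral_fourierFun]
  split_ifs with h
  · subst h; simp
  · obtain ⟨j, hj⟩ := Function.ne_iff.1 h
    exact Finset.prod_eq_zero (Finset.mem_univ j) (if_neg hj)

theorem span_fourierFun :
    (Submodule.span ℂ (Set.range P.fourierFun)).topologicalClosure = ⊤ := by
  rw [eq_top_iff, ← span_fourier_closure_eq_top (T := P.b - P.a)]
  refine Submodule.topologicalClosure_mono (Submodule.span_le.2 ?_)
  rintro _ ⟨k, rfl⟩
  have hc : (Real.sqrt (P.L / (P.b - P.a)) : ℂ) * fourier k (-((P.a : ℝ) : P.Circle)) ≠ 0 := by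
    refine mul_ne_zero P.sqrt_ne_zero ?_
    rw [fourier_apply]; exact _root_.Circle.coe_ne_zero _
  have : fourier k = ((Real.sqrt (P.L / (P.b - P.a)) : ℂ) *
      fourier k (-((P.a : ℝ) : P.Circle)))⁻¹ • P.fourierFun k := by
    ext x
    rw [ContinuousMap.smul_apply, fourierFun_eq, smul_eq_mul, inv_mul_cancel_left₀ hc]
  rw [this]
  exact Submodule.smul_mem _ _ (Submodule.subset_span ⟨k, rfl⟩)

/-- The unnormalised exponential monomials on the torus. -/
def monomial {d : ℕ} (k : Fin d → ℤ) : C(Fin d → P.Circle, ℂ) where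
  toFun x := ∏ j, fourier (k j) (x j)
  continuous_toFun := by fun_prop

theorem span_monomial (d : ℕ) :
    (Submodule.span ℂ (Set.range (P.monomial (d := d)))).topologicalClosure = ⊤ := by
  classical
  let S : StarSubalgebra ℂ C(Fin d → P.Circle, ℂ) :=
    { toSubalgebra := Algebra.adjoin ℂ (Set.range (P.monomial (d := d)))
      star_mem' := by
        change Algebra.adjoin ℂ (Set.range (P.monomial (d := d))) ≤
          star (Algebra.adjoin ℂ (Set.range (P.monomial (d := d))))
        refine Algebra.adjoin_le ?_
        rintro _ ⟨n, rfl⟩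
        refine Algebra.subset_adjoin ⟨-n, ?_⟩
        ext1 x
        change ∏ j, fourier (-n j) (x j) = conj (∏ j, fourier (n j) (x j))
        simp_rw [fourier_neg, map_prod] }
  have hS : Subalgebra.toSubmodule S.toSubalgebra =
      Submodule.span ℂ (Set.range (P.monomial (d := d))) := by
    apply Algebra.adjoin_eq_span_of_subset
    refine .trans (fun x ↦ Submonoid.closure_induction (fun _ ↦ id) ⟨0, ?_⟩ ?_)
      Submodule.subset_span
    · ext z
      change ∏ j, fourier 0 (z j) = 1
      simp_rw [fourier_zero, Finset.prod_const_one]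
    · rintro _ _ _ _ ⟨m, rfl⟩ ⟨n, rfl⟩
      refine ⟨m + n, ?_⟩
      ext z
      change ∏ j, fourier (m j + n j) (z j) = (∏ j, fourier (m j) (z j)) * ∏ j, fourier (n j) (z j)
      simp_rw [fourier_add, Finset.prod_mul_distrib]
  have hsep : S.SeparatesPoints := by
    intro x y hxy
    obtain ⟨i, hi⟩ := Function.ne_iff.1 hxy
    refine ⟨_, ⟨P.monomial (Pi.single i 1), Algebra.subset_adjoin ⟨Pi.single i 1, rfl⟩, rfl⟩, ?_⟩
    have hs : ∀ z : Fin d → P.Circle, P.monomial (Pi.single i 1) z = fourier 1 (z i) := by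
      intro z
      change ∏ j, fourier ((Pi.single i (1 : ℤ) : Fin d → ℤ) j) (z j) = _
      rw [Finset.prod_eq_single i]
      · rw [Pi.single_eq_same]
      · intro j _ hj
        rw [Pi.single_eq_of_ne hj, fourier_zero]
      · simp
    change P.monomial (Pi.single i 1) x ≠ P.monomial (Pi.single i 1) y
    rw [hs, hs, fourier_one, fourier_one]
    exact fun h => hi (AddCircle.injective_toCircle (sub_pos.2 P.a_lt_b).ne'
      (_root_.Circle.coe_injective h))
  rw [← hS]
  exact congr_arg (Subalgebra.toSubmodule <| StarSubalgebra.toSubalgebra ·)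
    (ContinuousMap.starSubalgebra_topologicalClosure_eq_top_of_separatesPoints S hsep)

theorem span_fourierFunTorus (d : ℕ) :
    (Submodule.span ℂ (Set.range (P.fourierFunTorus (d := d)))).topologicalClosure = ⊤ := by
  rw [eq_top_iff, ← P.span_monomial d]
  refine Submodule.topologicalClosure_mono (Submodule.span_le.2 ?_)
  rintro _ ⟨k, rfl⟩
  set c : ℂ := ∏ j, ((Real.sqrt (P.L / (P.b - P.a)) : ℂ) *
    fourier (k j) (-((P.a : ℝ) : P.Circle))) with hcdef
  have hc : c ≠ 0 := by
    refine Finset.prod_ne_zero_iff.2 fun j _ => mul_ne_zero P.sqrt_ne_zero ?_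
    rw [fourier_apply]; exact _root_.Circle.coe_ne_zero _
  have : P.monomial k = c⁻¹ • P.fourierFunTorus k := by
    ext x
    have h1 : P.fourierFunTorus k x = c * P.monomial k x := by
      change ∏ j, P.fourierFun (k j) (x j) = c * ∏ j, fourier (k j) (x j)
      simp_rw [fourierFun_eq]
      rw [Finset.prod_mul_distrib]
    rw [ContinuousMap.smul_apply, h1, smul_eq_mul, inv_mul_cancel_left₀ hc]
  rw [this]
  exact Submodule.smul_mem _ _ (Submodule.subset_span ⟨k, rfl⟩)

theorem toLp_span {α ι : Type*} [TopologicalSpace α] [CompactSpace α] [NormalSpace α]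
    [MeasurableSpace α] [BorelSpace α] [SecondCountableTopologyEither α ℂ] (μ : Measure α)
    [IsFiniteMeasure μ] [μ.WeaklyRegular] (e : ι → C(α, ℂ))
    (he : (Submodule.span ℂ (Set.range e)).topologicalClosure = ⊤) :
    ⊤ ≤ (Submodule.span ℂ (Set.range fun k =>
      ContinuousMap.toLp (E := ℂ) 2 μ ℂ (e k))).topologicalClosure := by
  have h := (ContinuousMap.toLp_denseRange ℂ μ ℂ
    (p := 2) (by norm_num)).topologicalClosure_map_submodule he
  rw [Submodule.map_span, ← Set.range_comp] at h
  exact h.ge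

/-- The Fourier basis `(b_k)_{k ∈ ℤ}` of `L₂(𝕋)`. -/
def fourierBasis : HilbertBasis ℤ ℂ P.L2 :=
  HilbertBasis.mk P.orthonormal_fourierFun (toLp_span _ _ P.span_fourierFun)

/-- The Fourier basis `(b_k)_{k ∈ ℤ^d}` of `L₂(𝕋^d)`. -/
def fourierBasisTorus (d : ℕ) : HilbertBasis (Fin d → ℤ) ℂ (P.L2Torus d) :=
  HilbertBasis.mk (P.orthonormal_fourierFunTorus d) (toLp_span _ _ (P.span_fourierFunTorus d))

end TorusModel

/-! ### Sobolev spaces of dominating mixed smoothness -/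

/-- Fourier weights: a nondecreasing sequence `1 = w_0 ≤ w_1 ≤ …`, extended by `w_{-k} = w_k`. -/
structure FourierWeight where
  w : ℕ → ℝ
  mono : Monotone w
  zero : w 0 = 1

namespace FourierWeight

theorem one_le (w : FourierWeight) (k : ℕ) : 1 ≤ w.w k := w.zero ▸ w.mono (Nat.zero_le k)

/-- The univariate weights `w_k`, `k ∈ ℤ`. -/
def uni (w : FourierWeight) : Weight ℤ where
  toFun k := w.w k.natAbs
  one_le _ := w.one_le _

/-- The tensor product weights `w_{k_1} ⋯ w_{k_d}`, `k ∈ ℤ^d`. -/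
def mix (w : FourierWeight) (d : ℕ) : Weight (Fin d → ℤ) where
  toFun k := ∏ j, w.w (k j).natAbs
  one_le _ := by
    rw [← Finset.prod_const_one (s := (Finset.univ : Finset (Fin d))) (M := ℝ)]
    exact Finset.prod_le_prod (fun _ _ => zero_le_one) fun j _ => w.one_le _

end FourierWeight

namespace TorusModel

variable (P : TorusModel)

/-- The univariate Sobolev space `H^w(𝕋)`. -/
abbrev Sobolev (w : FourierWeight) : Type := WeightedSpace P.fourierBasis w.uni

/-- The space `H^w_mix(𝕋^d)`, with norm `‖f‖² = ∑_{k ∈ ℤ^d} (w_{k_1} ⋯ w_{k_d})² |⟨f, b_k⟩|²`. It is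
the `d`-th tensor power of `H^w(𝕋)`: see `sobolevMix_tensor` and `sobolevMix_dense`. -/
abbrev SobolevMix (w : FourierWeight) (d : ℕ) : Type :=
  WeightedSpace (P.fourierBasisTorus d) (w.mix d)

/-- The embedding of `H^w_mix(𝕋^d)` into `L₂(𝕋^d)`. -/
def mixEmbedding (w : FourierWeight) (d : ℕ) : P.SobolevMix w d →L[ℂ] P.L2Torus d :=
  WeightedSpace.embedding (P.fourierBasisTorus d) (w.mix d)

end TorusModel

namespace TorusModel

variable (P : TorusModel)

/-- `F = f_1 ⊗ ⋯ ⊗ f_d`, that is, `F(x) = f_1(x_1) ⋯ f_d(x_d)` almost everywhere. -/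
def IsTensor {d : ℕ} (F : P.L2Torus d) (f : Fin d → P.L2) : Prop :=
  F =ᵐ[P.torusMeasure d] fun x => ∏ j, f j (x j)

theorem aestronglyMeasurable_tensor {d : ℕ} (f : Fin d → P.L2) :
    AEStronglyMeasurable (fun x : Fin d → P.Circle => ∏ j, f j (x j)) (P.torusMeasure d) := by
  refine Finset.aestronglyMeasurable_fun_prod (f := fun j (x : Fin d → P.Circle) => f j (x j)) _
    fun j _ => ?_
  exact (Lp.aestronglyMeasurable (f j)).comp_quasiMeasurePreserving
    (Measure.quasiMeasurePreserving_eval (μ := fun _ : Fin d => P.circleMeasure) j)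

theorem memLp_tensor {d : ℕ} (f : Fin d → P.L2) :
    MemLp (fun x : Fin d → P.Circle => ∏ j, f j (x j)) 2 (P.torusMeasure d) := by
  rw [memLp_two_iff_integrable_sq_norm (P.aestronglyMeasurable_tensor f)]
  have h : ∀ j, Integrable (fun x => ‖f j x‖ ^ 2) P.circleMeasure := fun j =>
    (memLp_two_iff_integrable_sq_norm (Lp.aestronglyMeasurable (f j))).1 (Lp.memLp (f j))
  simp_rw [norm_prod, ← Finset.prod_pow]
  exact Integrable.fintype_prod (f := fun j x => ‖f j x‖ ^ 2) h

theorem fourierBasis_coe (k : ℤ) : P.fourierBasis k =ᵐ[P.circleMeasure] P.fourierFun k := by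
  rw [fourierBasis, HilbertBasis.coe_mk]
  exact ContinuousMap.coeFn_toLp _ _

theorem fourierBasisTorus_coe {d : ℕ} (k : Fin d → ℤ) :
    P.fourierBasisTorus d k =ᵐ[P.torusMeasure d] P.fourierFunTorus k := by
  rw [fourierBasisTorus, HilbertBasis.coe_mk]
  exact ContinuousMap.coeFn_toLp _ _

theorem isTensor_basis {d : ℕ} (k : Fin d → ℤ) :
    P.IsTensor (P.fourierBasisTorus d k) fun j => P.fourierBasis (k j) := by
  refine (P.fourierBasisTorus_coe k).trans ?_
  have h : ∀ j : Fin d, ∀ᵐ x ∂P.torusMeasure d,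
      P.fourierBasis (k j) (x j) = P.fourierFun (k j) (x j) := fun j =>
    (Measure.quasiMeasurePreserving_eval (μ := fun _ : Fin d => P.circleMeasure) j).ae
      (P.fourierBasis_coe (k j))
  filter_upwards [ae_all_iff.2 h] with x hx
  change ∏ j, P.fourierFun (k j) (x j) = _
  exact Finset.prod_congr rfl fun j _ => (hx j).symm

theorem inner_tensor {d : ℕ} {F G : P.L2Torus d} {f g : Fin d → P.L2}
    (hF : P.IsTensor F f) (hG : P.IsTensor G g) : ⟪F, G⟫_ℂ = ∏ j, ⟪f j, g j⟫_ℂ := by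
  simp_rw [L2.inner_def]
  rw [← integral_fintype_prod_eq_prod (ι := Fin d) (f := fun j y => ⟪f j y, g j y⟫_ℂ)]
  refine integral_congr_ae ?_
  filter_upwards [hF, hG] with x hx hy
  rw [hx, hy]
  simp only [RCLike.inner_apply, map_prod, Finset.prod_mul_distrib]

theorem repr_tensor {d : ℕ} {F : P.L2Torus d} {f : Fin d → P.L2} (hF : P.IsTensor F f)
    (k : Fin d → ℤ) :
    (P.fourierBasisTorus d).repr F k = ∏ j, P.fourierBasis.repr (f j) (k j) := by
  simp_rw [HilbertBasis.repr_apply_apply]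
  exact P.inner_tensor (P.isTensor_basis k) hF

theorem hasSum_pi_prod : ∀ {d : ℕ} (g : Fin d → ℤ → ℂ), (∀ j, Summable fun k => ‖g j k‖) →
    Summable (fun k : Fin d → ℤ => ‖∏ j, g j (k j)‖) ∧
      HasSum (fun k : Fin d → ℤ => ∏ j, g j (k j)) (∏ j, ∑' k, g j k)
  | 0, g, _ => by
    refine ⟨(hasSum_fintype _).summable, ?_⟩
    simp
  | d + 1, g, h => by
    obtain ⟨h1, h2⟩ := hasSum_pi_prod (fun j => g j.succ) fun j => h j.succ
    let e : ℤ × (Fin d → ℤ) ≃ (Fin (d + 1) → ℤ) := Fin.consEquiv fun _ => ℤ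
    have he : ∀ q : ℤ × (Fin d → ℤ),
        ∏ j, g j (e q j) = g 0 q.1 * ∏ j : Fin d, g j.succ (q.2 j) := by
      intro q
      rw [Fin.prod_univ_succ]
      simp [e, Fin.consEquiv]
    have hs : Summable fun q : ℤ × (Fin d → ℤ) => ‖g 0 q.1 * ∏ j : Fin d, g j.succ (q.2 j)‖ :=
      summable_mul_of_summable_norm (h 0) h1 |>.norm
    constructor
    · rw [← e.summable_iff]
      simpa only [Function.comp_def, he] using hs
    · rw [← e.hasSum_iff, Fin.prod_univ_succ]
      simp only [Function.comp_def, he]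
      rw [← h2.tsum_eq, tsum_mul_tsum_of_summable_norm (h 0) h1]
      exact hs.of_norm.hasSum

theorem weight_mul_repr_tensor (w : FourierWeight) {d : ℕ} {F : P.L2Torus d}
    {f : Fin d → P.Sobolev w} (hF : P.IsTensor F fun j => WeightedSpace.incl _ _ (f j))
    (k : Fin d → ℤ) : ((w.mix d).toFun k : ℂ) * (P.fourierBasisTorus d).repr F k =
      ∏ j, WeightedSpace.coeff P.fourierBasis w.uni (f j) (k j) := by
  rw [P.repr_tensor hF]
  simp_rw [WeightedSpace.coeff_apply]
  rw [Finset.prod_mul_distrib]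
  have h : (w.mix d).toFun k = ∏ j, w.uni.toFun (k j) := rfl
  rw [h, Complex.ofReal_prod]

/-- Tensor products of elements of `H^w(𝕋)` belong to `H^w_mix(𝕋^d)`. -/
theorem sobolevMix_tensor (w : FourierWeight) {d : ℕ} (f : Fin d → P.Sobolev w) :
    ∃ F : P.SobolevMix w d, P.IsTensor (WeightedSpace.incl _ _ F)
      fun j => WeightedSpace.incl _ _ (f j) := by
  set f' : Fin d → P.L2 := fun j => WeightedSpace.incl _ _ (f j) with hf'
  let F : P.L2Torus d := (P.memLp_tensor f').toLp _
  have hF : P.IsTensor F f' := MemLp.coeFn_toLp _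
  have h2 : (0 : ℝ) < (2 : ℝ≥0∞).toReal := by norm_num
  have hmem : F ∈ weightedSubmodule (P.fourierBasisTorus d) (w.mix d) := by
    change Memℓp (fun k => ((w.mix d).toFun k : ℂ) * (P.fourierBasisTorus d).repr F k) 2
    refine memℓp_gen ?_
    have hj : ∀ j, Summable fun k : ℤ =>
        ‖((‖WeightedSpace.coeff _ _ (f j) k‖ ^ (2 : ℝ≥0∞).toReal : ℝ) : ℂ)‖ := by
      intro j
      have := (lp.memℓp (WeightedSpace.coeff _ _ (f j))).summable h2
      simpa only [Complex.norm_real] using this.norm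
    refine (hasSum_pi_prod _ hj).1.congr fun k => ?_
    have hk : ((w.mix d).toFun k : ℂ) * (P.fourierBasisTorus d).repr F k =
        ∏ j, WeightedSpace.coeff _ _ (f j) (k j) := P.weight_mul_repr_tensor w hF k
    rw [hk, norm_prod, norm_prod, ← Real.finsetProd_rpow _ _ fun _ _ => norm_nonneg _]
    refine Finset.prod_congr rfl fun j _ => ?_
    rw [Complex.norm_real, Real.norm_of_nonneg (by positivity)]
  exact ⟨⟨F, hmem⟩, hF⟩

/-- The scalar product of `H^w_mix(𝕋^d)` is multiplicative on tensor products. -/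
theorem sobolevMix_inner (w : FourierWeight) {d : ℕ} {f g : Fin d → P.Sobolev w}
    {F G : P.SobolevMix w d}
    (hF : P.IsTensor (WeightedSpace.incl _ _ F) fun j => WeightedSpace.incl _ _ (f j))
    (hG : P.IsTensor (WeightedSpace.incl _ _ G) fun j => WeightedSpace.incl _ _ (g j)) :
    ⟪F, G⟫_ℂ = ∏ j, ⟪f j, g j⟫_ℂ := by
  simp_rw [WeightedSpace.inner_eq, lp.inner_eq_tsum]
  have hj : ∀ j, Summable fun k : ℤ => ‖⟪WeightedSpace.coeff P.fourierBasis w.uni (f j) k,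
      WeightedSpace.coeff P.fourierBasis w.uni (g j) k⟫_ℂ‖ := by
    intro j
    have h := lp.summable_inner (𝕜 := ℂ) (WeightedSpace.coeff P.fourierBasis w.uni (f j))
      (WeightedSpace.coeff P.fourierBasis w.uni (g j))
    exact h.norm
  rw [← (hasSum_pi_prod _ hj).2.tsum_eq]
  refine tsum_congr fun k => ?_
  have h1 : WeightedSpace.coeff _ _ F k = ∏ j, WeightedSpace.coeff _ _ (f j) (k j) :=
    P.weight_mul_repr_tensor w hF k
  have h2 : WeightedSpace.coeff _ _ G k = ∏ j, WeightedSpace.coeff _ _ (g j) (k j) :=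
    P.weight_mul_repr_tensor w hG k
  rw [h1, h2]
  simp only [RCLike.inner_apply, Finset.prod_mul_distrib, map_prod]

/-- Tensor products of elements of `H^w(𝕋)` span a dense subspace of `H^w_mix(𝕋^d)`. -/
theorem sobolevMix_dense (w : FourierWeight) (d : ℕ) :
    (Submodule.span ℂ {F : P.SobolevMix w d | ∃ f : Fin d → P.Sobolev w,
      P.IsTensor (WeightedSpace.incl _ _ F)
        fun j => WeightedSpace.incl _ _ (f j)}).topologicalClosure = ⊤ := by
  classical
  rw [Submodule.topologicalClosure_eq_top_iff, Submodule.eq_bot_iff]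
  intro G hG
  rw [Submodule.mem_orthogonal] at hG
  apply WeightedSpace.coeff_injective
  rw [map_zero]
  ext k
  obtain ⟨f, hf⟩ : ∃ f : Fin d → P.Sobolev w, ∀ j,
      WeightedSpace.incl _ _ (f j) = P.fourierBasis (k j) := by
    refine ⟨fun j => ⟨P.fourierBasis (k j), ?_⟩, fun j => rfl⟩
    change Memℓp (fun i => (w.uni.toFun i : ℂ) * P.fourierBasis.repr (P.fourierBasis (k j)) i) 2
    refine memℓp_gen (summable_of_ne_finset_zero (s := {k j}) fun i hi => ?_)
    rw [HilbertBasis.repr_self, lp.single_apply_ne _ _ _ (by simpa using hi)]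
    simp
  obtain ⟨F, hF⟩ := P.sobolevMix_tensor w f
  have hF0 : WeightedSpace.incl _ _ F = P.fourierBasisTorus d k := by
    apply Lp.ext
    simp_rw [hf] at hF
    exact hF.trans (P.isTensor_basis k).symm
  have h0 := hG F (Submodule.subset_span ⟨f, hF⟩)
  have hFc : WeightedSpace.coeff _ _ F = lp.single 2 k (((w.mix d).toFun k : ℂ)) := by
    ext i
    rw [WeightedSpace.coeff_apply, hF0, HilbertBasis.repr_self]
    by_cases hi : i = k
    · subst hi; simp
    · rw [lp.single_apply_ne _ _ _ hi, lp.single_apply_ne _ _ _ hi, mul_zero]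
  rw [WeightedSpace.inner_eq, hFc, lp.inner_single_left, RCLike.inner_apply] at h0
  have hw : (starRingEnd ℂ) ((w.mix d).toFun k : ℂ) ≠ 0 := by
    rw [Complex.conj_ofReal]
    exact WeightedSpace.weight_ne_zero _ k
  exact (mul_eq_zero.1 h0).resolve_right hw

end TorusModel

/-- The labels `∘`, `*`, `+`, `#` of the four norms. -/
inductive NormKind
  | circ
  | star
  | plus
  | sharp

/-- The weight `w_k` of each of the four norms, as a function of `t = γ⁻¹ · 2πk/(b-a)`. The sum
for `∘` runs over `l = 0, …, s` and is meant for integer `s`. -/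
def NormKind.weightAt (kind : NormKind) (s t : ℝ) : ℝ :=
  match kind with
  | .circ => (∑ l ∈ Finset.range (⌊s⌋₊ + 1), |t| ^ (2 * l)) ^ (1 / 2 : ℝ)
  | .star => (1 + |t| ^ (2 * s)) ^ (1 / 2 : ℝ)
  | .plus => (1 + |t| ^ 2) ^ (s / 2)
  | .sharp => (1 + |t|) ^ s

theorem NormKind.weightAt_zero (kind : NormKind) {s : ℝ} (hs : 0 < s) :
    kind.weightAt s 0 = 1 := by
  cases kind with
  | circ =>
    rw [weightAt, Finset.sum_eq_single 0] <;> simp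
  | star => simp [weightAt, Real.zero_rpow (by positivity : 2 * s ≠ 0)]
  | plus => simp [weightAt]
  | sharp => simp [weightAt]

theorem NormKind.weightAt_mono (kind : NormKind) {s : ℝ} (hs : 0 < s) {t u : ℝ} (h : |t| ≤ |u|) :
    kind.weightAt s t ≤ kind.weightAt s u := by
  cases kind <;> simp only [weightAt] <;> gcongr

/-- The weights of `H^{s,□,γ}_mix`. -/
def sobolevWeight (P : TorusModel) (kind : NormKind) {s : ℝ} (hs : 0 < s) (γ : ℝ) :
    FourierWeight where
  w k := kind.weightAt s (γ⁻¹ * (2 * Real.pi * k / (P.b - P.a)))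
  mono k l hkl := by
    have h0 : (0 : ℝ) < P.b - P.a := sub_pos.2 P.a_lt_b
    have hkl' : (k : ℝ) ≤ l := by exact_mod_cast hkl
    refine kind.weightAt_mono hs ?_
    rw [abs_mul, abs_mul, abs_of_nonneg (by positivity : 0 ≤ 2 * Real.pi * k / (P.b - P.a)),
      abs_of_nonneg (by positivity : 0 ≤ 2 * Real.pi * l / (P.b - P.a))]
    gcongr
  zero := by
    simp [kind.weightAt_zero hs]

/-- `a_n(H^{s,□,γ}_mix(𝕋^d) ↪ L₂(𝕋^d))`. -/
def mixApproxNumber (P : TorusModel) (kind : NormKind) {s : ℝ} (hs : 0 < s) (γ : ℝ)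
    (d n : ℕ) : ℝ :=
  approxNumber n (P.mixEmbedding (sobolevWeight P kind hs γ) d)

/-! ### The tabulated constants and exponents -/

/-- `η = 2π / (γ (b - a))`. -/
def eta (P : TorusModel) (γ : ℝ) : ℝ := 2 * Real.pi / (γ * (P.b - P.a))

/-- `σ_□(2)`. -/
def NormKind.sigmaTwo (kind : NormKind) (s η : ℝ) : ℝ :=
  match kind with
  | .circ => (∑ l ∈ Finset.range (⌊s⌋₊ + 1), η ^ (2 * l)) ^ (-(1 / 2) : ℝ)
  | .star => (1 + η ^ (2 * s)) ^ (-(1 / 2) : ℝ)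
  | .plus => (1 + η ^ 2) ^ (-(s / 2))
  | .sharp => (1 + η) ^ (-s)

/-- `α_□(d, δ)`. -/
def NormKind.alpha (kind : NormKind) (s η : ℝ) (d : ℕ) (δ : ℝ) : ℝ :=
  match kind with
  | .circ => (1 / 2 * Real.log (∑ l ∈ Finset.range (⌊s⌋₊ + 1), η ^ (2 * l))) /
      (Real.log d + (1 + δ) / (2 * s) *
        Real.log (∑ l ∈ Finset.range (⌊s⌋₊ + 1), η ^ (2 * l)))
  | .star => (1 / 2 * Real.log (1 + η ^ (2 * s))) /
      (Real.log d + (1 + δ) / (2 * s) * Real.log (1 + η ^ (2 * s)))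
  | .plus => (s / 2 * Real.log (1 + η ^ 2)) /
      (Real.log d + (1 + δ) / 2 * Real.log (1 + η ^ 2))
  | .sharp => (s * Real.log (1 + η)) / (Real.log d + (1 + δ) * Real.log (1 + η))

/-- `β_□(d, n)`. -/
def NormKind.beta (kind : NormKind) (s η : ℝ) (d n : ℕ) : ℝ :=
  match kind with
  | .circ => (1 / 2 * Real.log (∑ l ∈ Finset.range (⌊s⌋₊ + 1), η ^ (2 * l))) /
      Real.log (1 + 2 / Real.logb 3 n * d)
  | .star => (1 / 2 * Real.log (1 + η ^ (2 * s))) / Real.log (1 + 2 / Real.logb 3 n * d)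
  | .plus => (s / 2 * Real.log (1 + η ^ 2)) / Real.log (1 + 2 / Real.logb 3 n * d)
  | .sharp => (s * Real.log (1 + η)) / Real.log (1 + 2 / Real.logb 3 n * d)

/-- `C̃(δ) = exp((3/η)^{1+δ}/δ)`. -/
def tildeC (η δ : ℝ) : ℝ := Real.exp ((3 / η) ^ (1 + δ) / δ)

end TorusApprox

end

namespace TorusApprox

/-! ### Approximation numbers of weighted embeddings -/

section Weighted

variable {ι Y : Type*} [NormedAddCommGroup Y] [InnerProductSpace ℂ Y]

/-! The embedding is diagonal: it maps the orthonormal basis `b_k / W_k` of the source to `W_k⁻¹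
b_k`, where `W_k = ∏ w_{k_j}`. So `a_n` is governed by counting: if fewer than `n` indices satisfy
`r W_k < 1`, then `a_n ≤ r` (`approxNumber_embedding_le`); if at least `n` satisfy `r W_k ≤ 1`, then
`a_n ≥ r` (`le_approxNumber_embedding`). What remains is to count lattice points with small `W_k`.

Lower bound: a vector in `{-1,0,1}^d` with at most `m` nonzero entries has `W_k ≤ w_1^m`, and there
are `∑_{i ≤ m} C(d,i) 2^i` of these. Let `m = l + 1` be the least level with at least `n` vectors,
so that `a_n ≥ w_1^{-(l+1)}`. Level `l` has fewer than `n` vectors, but at least `3^l`, and at least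
`(1 + 2d/l)^l` when `l > 0`. Hence `l ≤ log₃ n`, and then `l log(1 + 2d/log₃ n) ≤ log n`
(`exists_level`). The factor `w_1^{-l}` gives `n^{-β}`, and the remaining `w_1⁻¹` is `σ(2)`.

Upper bound: by Chebyshev's inequality the count is controlled by `∑_k W_k^{-p} = (1 + 2 ∑_{k ≥ 1}
w_k^{-p})^d`, with `p = 1/α = log d / log w_1 + (1+δ)/s`. The first part of `p` gains a factor
`1/d`, since `w_k ≥ w_1`; the second makes the series converge like `ζ(1+δ)`, since `w_k ≥ (ηk)^s`.
The `d`-th power is therefore at most `C̃(δ)`, independently of `d`.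

The four norms enter only through `w_1 > 1` and `w_k ≥ (ηk)^s`. -/

theorem approxNumber_le {X Y : Type*} [NormedAddCommGroup X] [NormedSpace ℂ X]
    [NormedAddCommGroup Y] [NormedSpace ℂ Y] {n : ℕ} {T A : X →L[ℂ] Y}
    (hA : LinearMap.rank (A : X →ₗ[ℂ] Y) < (n : Cardinal)) : approxNumber n T ≤ ‖T - A‖ := by
  refine csInf_le ⟨0, ?_⟩ ⟨A, hA, rfl⟩
  rintro _ ⟨_, _, rfl⟩
  exact norm_nonneg _

theorem le_approxNumber {X Y : Type*} [NormedAddCommGroup X] [NormedSpace ℂ X]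
    [NormedAddCommGroup Y] [NormedSpace ℂ Y] {n : ℕ} (hn : 0 < n) {T : X →L[ℂ] Y} {r : ℝ}
    (h : ∀ A : X →L[ℂ] Y, LinearMap.rank (A : X →ₗ[ℂ] Y) < (n : Cardinal) → r ≤ ‖T - A‖) :
    r ≤ approxNumber n T := by
  -- For `n > 0` the zero operator is admissible. For `n = 0` the set is empty and `sInf` takes the
  -- default value `0`.
  refine le_csInf ⟨_, 0, ?_, rfl⟩ ?_
  · have h0 : ((0 : X →L[ℂ] Y) : X →ₗ[ℂ] Y) = 0 := rfl
    rw [h0, LinearMap.rank_zero]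
    exact_mod_cast hn
  · rintro _ ⟨A, hA, rfl⟩
    exact h A hA

/-- A linear map of rank below `n` has a nontrivial zero on every `n`-dimensional
coordinate space. -/
theorem exists_ne_zero_of_rank_lt {X Y : Type*} [AddCommGroup X] [Module ℂ X]
    [AddCommGroup Y] [Module ℂ Y] {n : ℕ} {A : X →ₗ[ℂ] Y} (hA : A.rank < (n : Cardinal))
    {κ : Type*} [Fintype κ] (hκ : n ≤ Fintype.card κ) (E : (κ → ℂ) →ₗ[ℂ] X) :
    ∃ c : κ → ℂ, c ≠ 0 ∧ A (E c) = 0 := by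
  by_contra! hcon
  have hinj : Function.Injective (A ∘ₗ E) := by
    rw [← LinearMap.ker_eq_bot, LinearMap.ker_eq_bot']
    intro c hc
    by_contra h0
    exact hcon c h0 hc
  -- Without finiteness of the range, `finrank` could be the default value `0` and the dimension
  -- comparison would fail.
  have hfin : Module.Finite ℂ (LinearMap.range A) :=
    Module.rank_lt_aleph0_iff.1 (hA.trans (Cardinal.natCast_lt_aleph0 (n := n)))
  have h1 := LinearMap.finrank_le_finrank_of_injective
    (f := (A ∘ₗ E).codRestrict (LinearMap.range A) fun c => ⟨E c, rfl⟩)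
    (fun x y hxy => hinj (congrArg Subtype.val hxy))
  rw [Module.finrank_fintype_fun_eq_card] at h1
  have h2 : Module.finrank ℂ (LinearMap.range A) < n := Module.finrank_lt_of_rank_lt hA
  omega

/-- Truncating the basis expansion to `s` has rank at most `s.card`. The error keeps only
coefficients outside `s`, each at most `r` times the weighted coefficient. -/
theorem approxNumber_embedding_le (B : HilbertBasis ι ℂ Y) (v : Weight ι) {n : ℕ} {r : ℝ}
    (hr : 0 ≤ r) (s : Finset ι) (hs : s.card < n) (h : ∀ i ∉ s, 1 ≤ r * v.toFun i) :
    approxNumber n (WeightedSpace.embedding B v) ≤ r := by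
  classical
  let Q : Y →L[ℂ] Y := ∑ i ∈ s, (innerSL ℂ (B i)).smulRight (B i)
  have hQ : ∀ f, Q f = ∑ i ∈ s, B.repr f i • B i := by
    intro f
    simp [Q, HilbertBasis.repr_apply_apply]
  have hQr : ∀ f i, B.repr (Q f) i = if i ∈ s then B.repr f i else 0 := by
    intro f i
    rw [hQ, map_sum, lp.coeFn_sum, Finset.sum_apply]
    simp only [map_smul, HilbertBasis.repr_self, lp.coeFn_smul, Pi.smul_apply, lp.single_apply,
      Pi.single_apply]
    simp
  let A := Q ∘L WeightedSpace.embedding B v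
  have hA : LinearMap.rank (A : WeightedSpace B v →ₗ[ℂ] Y) < (n : Cardinal) := by
    have hle : LinearMap.range (A : WeightedSpace B v →ₗ[ℂ] Y) ≤
        Submodule.span ℂ ((s.image B : Finset Y) : Set Y) := by
      rintro _ ⟨f, rfl⟩
      change Q _ ∈ _
      rw [hQ]
      exact Submodule.sum_mem _ fun i hi => Submodule.smul_mem _ _
        (Submodule.subset_span (Finset.mem_coe.2 (Finset.mem_image_of_mem B hi)))
    calc LinearMap.rank (A : WeightedSpace B v →ₗ[ℂ] Y)
        ≤ Module.rank ℂ (Submodule.span ℂ ((s.image B : Finset Y) : Set Y)) :=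
          Submodule.rank_mono hle
      _ ≤ (s.image B).card := rank_span_finset_le _
      _ < n := by exact_mod_cast Finset.card_image_le.trans_lt hs
  refine (approxNumber_le hA).trans (ContinuousLinearMap.opNorm_le_bound _ hr fun f => ?_)
  rw [WeightedSpace.norm_eq, ← B.repr.norm_map]
  have h1 : r * ‖WeightedSpace.coeff B v f‖ = ‖(r : ℂ) • WeightedSpace.coeff B v f‖ := by
    rw [norm_smul, Complex.norm_real, Real.norm_of_nonneg hr]
  rw [h1]
  refine lp.norm_mono (by norm_num) fun i => ?_
  have h2 : B.repr ((WeightedSpace.embedding B v - A) f) i =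
      B.repr (WeightedSpace.incl B v f) i - B.repr (Q (WeightedSpace.incl B v f)) i := by
    rw [_root_.sub_apply, map_sub]
    rfl
  rw [h2, hQr, lp.coeFn_smul, Pi.smul_apply, WeightedSpace.coeff_apply, norm_smul, norm_mul,
    Complex.norm_real, Complex.norm_real, Real.norm_of_nonneg hr,
    Real.norm_of_nonneg (zero_le_one.trans (v.one_le i)), ← mul_assoc]
  split_ifs with hi
  · rw [sub_self, norm_zero]
    have := zero_le_one.trans (v.one_le i)
    positivity
  · rw [sub_zero]
    exact le_mul_of_one_le_left (norm_nonneg _) (h i hi)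

/-- An `A` of rank below `n` kills some nonzero `f` spanned by the `B i`, `i ∈ s`. On this `f` the
error equals the embedding, which shrinks norms there by a factor of at least `r`. -/
theorem le_approxNumber_embedding (B : HilbertBasis ι ℂ Y) (v : Weight ι) {n : ℕ} (hn : 0 < n)
    {r : ℝ} (hr : 0 ≤ r) (s : Finset ι) (hs : n ≤ s.card) (h : ∀ i ∈ s, r * v.toFun i ≤ 1) :
    r ≤ approxNumber n (WeightedSpace.embedding B v) := by
  classical
  refine le_approxNumber hn fun A hA => ?_
  -- `E` uses the vectors `B i / v_i`, orthonormal for the weighted product, so the weighted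
  -- coefficients of `E c` are `c` itself.
  let E : (s → ℂ) →ₗ[ℂ] WeightedSpace B v := Fintype.linearCombination ℂ
    fun i : s => (WeightedSpace.coeffEquiv B v).symm (lp.single 2 (i : ι) (1 : ℂ))
  have hE : ∀ c i, WeightedSpace.coeff B v (E c) i = if hi : i ∈ s then c ⟨i, hi⟩ else 0 := by
    intro c i
    have h1 : WeightedSpace.coeff B v (E c) =
        ∑ j : s, c j • lp.single (E := fun _ : ι => ℂ) 2 (j : ι) (1 : ℂ) := by
      change WeightedSpace.coeff B v (Fintype.linearCombination ℂ _ c) = _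
      rw [Fintype.linearCombination_apply, map_sum]
      refine Finset.sum_congr rfl fun j _ => ?_
      rw [map_smul]
      congr 1
      exact (WeightedSpace.coeffEquiv B v).apply_symm_apply _
    rw [h1, lp.coeFn_sum, Finset.sum_apply]
    simp only [lp.coeFn_smul, Pi.smul_apply, lp.single_apply, Pi.single_apply, smul_eq_mul,
      mul_ite, mul_one, mul_zero]
    split_ifs with hi
    · rw [Finset.sum_eq_single ⟨i, hi⟩]
      · simp
      · intro j _ hj
        rw [if_neg]
        rintro rfl
        exact hj rfl
      · simp
    · refine Finset.sum_eq_zero fun j _ => if_neg ?_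
      rintro rfl
      exact hi j.2
  obtain ⟨c, hc, hAc⟩ := exists_ne_zero_of_rank_lt hA (by simpa using hs) E
  have hf : 0 < ‖E c‖ := by
    rw [norm_pos_iff]
    intro h0
    refine hc (funext fun i => ?_)
    have := hE c i
    rw [h0, map_zero, dif_pos i.2] at this
    exact this.symm
  have h1 : r * ‖E c‖ ≤ ‖WeightedSpace.incl B v (E c)‖ := by
    have h2 : r * ‖E c‖ = ‖(r : ℂ) • WeightedSpace.coeff B v (E c)‖ := by
      rw [norm_smul, Complex.norm_real, Real.norm_of_nonneg hr, WeightedSpace.norm_eq]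
    rw [h2, ← B.repr.norm_map]
    refine lp.norm_mono (by norm_num) fun i => ?_
    rw [lp.coeFn_smul, Pi.smul_apply, norm_smul, Complex.norm_real, Real.norm_of_nonneg hr]
    by_cases hi : i ∈ s
    · rw [WeightedSpace.coeff_apply, norm_mul, Complex.norm_real,
        Real.norm_of_nonneg (zero_le_one.trans (v.one_le i)), ← mul_assoc]
      exact mul_le_of_le_one_left (norm_nonneg _) (h i hi)
    · rw [hE, dif_neg hi, norm_zero, mul_zero]
      exact norm_nonneg _
  have h3 : (WeightedSpace.embedding B v - A) (E c) = WeightedSpace.incl B v (E c) := by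
    rw [_root_.sub_apply]
    have : A (E c) = 0 := hAc
    rw [this, sub_zero]
    rfl
  have h4 := (WeightedSpace.embedding B v - A).le_opNorm (E c)
  rw [h3] at h4
  exact le_of_mul_le_mul_right (h1.trans h4) hf

end Weighted

/-! ### Counting lattice points with entries in `{-1, 0, 1}` -/

/-- For `l > 0`, `C(l,i) / l^i` is `1/i!` times the product of the factors `1 - j/l`, `j < i`, each
of which grows with `l`. -/
theorem choose_mul_pow_le_choose_mul_pow {l d : ℕ} (hld : l ≤ d) (i : ℕ) :
    l.choose i * d ^ i ≤ d.choose i * l ^ i := by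
  have key : l.descFactorial i * d ^ i ≤ d.descFactorial i * l ^ i := by
    induction i with
    | zero => simp
    | succ i ih =>
      -- Truncated subtraction is harmless: both sides are `l d` minus something, and `i l ≤ i d`.
      have h1 : (l - i) * d ≤ (d - i) * l := by
        rw [Nat.sub_mul, Nat.sub_mul, mul_comm d l]
        exact Nat.sub_le_sub_left (Nat.mul_le_mul_left i hld) _
      calc l.descFactorial (i + 1) * d ^ (i + 1)
          = ((l - i) * d) * (l.descFactorial i * d ^ i) := by
            rw [Nat.descFactorial_succ, pow_succ]; ring
        _ ≤ ((d - i) * l) * (d.descFactorial i * l ^ i) := Nat.mul_le_mul h1 ih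
        _ = d.descFactorial (i + 1) * l ^ (i + 1) := by
            rw [Nat.descFactorial_succ, pow_succ]; ring
  rw [Nat.descFactorial_eq_factorial_mul_choose, Nat.descFactorial_eq_factorial_mul_choose,
    mul_assoc, mul_assoc] at key
  exact Nat.le_of_mul_le_mul_left key i.factorial_pos

theorem three_pow_le_sum_choose {l d : ℕ} (hld : l ≤ d) :
    3 ^ l ≤ ∑ i ∈ Finset.range (l + 1), d.choose i * 2 ^ i := by
  calc 3 ^ l = (2 + 1) ^ l := rfl
    _ = ∑ i ∈ Finset.range (l + 1), l.choose i * 2 ^ i := by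
      rw [add_pow]
      refine Finset.sum_congr rfl fun i _ => ?_
      rw [one_pow, mul_one, mul_comm, Nat.cast_id]
    _ ≤ _ := Finset.sum_le_sum fun i _ => Nat.mul_le_mul_right _ (Nat.choose_le_choose i hld)

/-- In the binomial expansion each term `C(l,i) (2d/l)^i` is at most `C(d,i) 2^i`. -/
theorem one_add_div_pow_le_sum_choose {l d : ℕ} (hl : 0 < l) (hld : l ≤ d) :
    (1 + 2 * (d : ℝ) / l) ^ l ≤
      ((∑ i ∈ Finset.range (l + 1), d.choose i * 2 ^ i : ℕ) : ℝ) := by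
  have hl' : (0 : ℝ) < l := by exact_mod_cast hl
  rw [add_comm, add_pow]
  push_cast
  refine Finset.sum_le_sum fun i _ => ?_
  have h : (l.choose i : ℝ) * d ^ i ≤ d.choose i * l ^ i := by
    exact_mod_cast choose_mul_pow_le_choose_mul_pow hld i
  rw [one_pow, mul_one, div_pow, mul_pow, div_mul_eq_mul_div, div_le_iff₀ (by positivity)]
  calc 2 ^ i * (d : ℝ) ^ i * l.choose i = 2 ^ i * (l.choose i * d ^ i) := by ring
    _ ≤ 2 ^ i * (d.choose i * l ^ i) := by gcongr
    _ = _ := by ring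

/-- There are at least `∑_{i ≤ m} C(d, i) 2^i` sign vectors with at most `m` nonzero entries. -/
theorem exists_finset_sign_vectors (d m : ℕ) : ∃ s : Finset (Fin d → ℤ),
    ∑ i ∈ Finset.range (m + 1), d.choose i * 2 ^ i ≤ s.card ∧
    ∀ k ∈ s, ∃ t : Finset (Fin d), t.card ≤ m ∧
      ∀ j, (j ∈ t → (k j).natAbs = 1) ∧ (j ∉ t → k j = 0) := by
  classical
  let g : Finset (Fin d) → Finset (Fin d → ℤ) := fun t =>
    Fintype.piFinset fun j => if j ∈ t then {1, -1} else {0}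
  have hg : ∀ t k, k ∈ g t → ∀ j, (j ∈ t → (k j).natAbs = 1) ∧ (j ∉ t → k j = 0) := by
    intro t k hk j
    have := Fintype.mem_piFinset.1 hk j
    constructor
    · intro hj
      rw [if_pos hj] at this
      rcases Finset.mem_insert.1 this with h | h
      · rw [h]; rfl
      · rw [Finset.mem_singleton.1 h]; rfl
    · intro hj
      rw [if_neg hj] at this
      exact Finset.mem_singleton.1 this
  have hcard : ∀ t, (g t).card = 2 ^ t.card := by
    intro t
    rw [Fintype.card_piFinset]
    have : ∀ j, (if j ∈ t then ({1, -1} : Finset ℤ) else {0}).card = if j ∈ t then 2 else 1 := by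
      intro j
      split_ifs <;> rfl
    simp_rw [this]
    simp
  -- A vector determines `t` as its support, so the classes for different supports do not overlap
  -- and their sizes add up.
  have hdisj : ∀ t t', t ≠ t' → Disjoint (g t) (g t') := by
    intro t t' h
    rw [Finset.disjoint_left]
    intro k hk hk'
    refine h (Finset.ext fun j => ?_)
    have h1 := hg t k hk j
    have h2 := hg t' k hk' j
    constructor
    · intro hj
      by_contra hj'
      have := h1.1 hj
      rw [h2.2 hj'] at this
      simp at this
    · intro hj
      by_contra hj'
      have := h2.1 hj
      rw [h1.2 hj'] at this
      simp at this
  refine ⟨(Finset.range (m + 1)).biUnion fun i =>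
    (Finset.powersetCard i Finset.univ).biUnion g, ?_, ?_⟩
  · rw [Finset.card_biUnion]
    · refine Finset.sum_le_sum fun i _ => ?_
      rw [Finset.card_biUnion fun t _ t' _ h => hdisj t t' h,
        Finset.sum_congr rfl fun t ht => by rw [hcard, (Finset.mem_powersetCard.1 ht).2]]
      simp
    · intro i _ i' _ h
      simp only [Function.onFun]
      rw [Finset.disjoint_biUnion_left]
      intro t ht
      rw [Finset.disjoint_biUnion_right]
      intro t' ht'
      refine hdisj t t' ?_
      rintro rfl
      exact h ((Finset.mem_powersetCard.1 ht).2.symm.trans (Finset.mem_powersetCard.1 ht').2)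
  · intro k hk
    simp only [Finset.mem_biUnion, Finset.mem_range, Finset.mem_powersetCard] at hk
    obtain ⟨i, hi, t, ⟨-, ht⟩, hk⟩ := hk
    exact ⟨t, by omega, hg t k hk⟩

/-- If `n ≤ 3^d`, then some `l < d` is at most `log n / log (1 + 2 d / log₃ n)`, while
`n ≤ ∑_{i ≤ l + 1} C(d, i) 2^i`. -/
theorem exists_level {d n : ℕ} (hn : 2 ≤ n) (hnd : n ≤ 3 ^ d) : ∃ l : ℕ,
    n ≤ ∑ i ∈ Finset.range (l + 1 + 1), d.choose i * 2 ^ i ∧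
    (l : ℝ) ≤ Real.log n / Real.log (1 + 2 / Real.logb 3 n * d) := by
  classical
  have hex : ∃ m, n ≤ ∑ i ∈ Finset.range (m + 1), d.choose i * 2 ^ i :=
    ⟨d, hnd.trans (three_pow_le_sum_choose le_rfl)⟩
  have hmd : Nat.find hex ≤ d := Nat.find_min' hex (hnd.trans (three_pow_le_sum_choose le_rfl))
  have hm := Nat.find_spec hex
  have hmin := fun l => Nat.find_min hex (m := l)
  generalize Nat.find hex = m at hmd hm hmin
  -- Level `0` contains only the zero vector and `n ≥ 2`, so the minimal level is a successor `l +
  -- 1`.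
  obtain _ | l := m
  · simp at hm
    omega
  refine ⟨l, hm, ?_⟩
  have hlt : ∑ i ∈ Finset.range (l + 1), d.choose i * 2 ^ i < n := not_le.1 (hmin l (by omega))
  have hld : l ≤ d := by omega
  have hn1 : (1 : ℝ) < n := by exact_mod_cast (by omega : 1 < n)
  have hlog : 0 < Real.log n := Real.log_pos hn1
  have hlogb : 0 < Real.logb 3 n := Real.logb_pos (by norm_num) hn1
  have hd : (0 : ℝ) < d := by exact_mod_cast (by omega : 0 < d)
  have hpos : 0 < Real.log (1 + 2 / Real.logb 3 n * d) :=
    Real.log_pos (lt_add_of_pos_right _ (by positivity))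
  -- The case `l = 0` is split off because `2d/l` is meaningless there.
  rcases Nat.eq_zero_or_pos l with rfl | hl
  · simp only [Nat.cast_zero]
    positivity
  rw [le_div_iff₀ hpos]
  have hl' : (0 : ℝ) < l := by exact_mod_cast hl
  -- Level `l` has at least `3^l` and fewer than `n` vectors; this allows `l` to be replaced by
  -- `log₃ n` inside the logarithm.
  have h1 : (l : ℝ) ≤ Real.logb 3 n := by
    rw [Real.le_logb_iff_rpow_le (by norm_num) (by linarith), Real.rpow_natCast]
    exact_mod_cast (three_pow_le_sum_choose hld).trans hlt.le
  have h2 : 1 + 2 / Real.logb 3 n * d ≤ 1 + 2 * (d : ℝ) / l := by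
    rw [div_mul_eq_mul_div]
    gcongr
  calc (l : ℝ) * Real.log (1 + 2 / Real.logb 3 n * d)
      ≤ l * Real.log (1 + 2 * (d : ℝ) / l) := by gcongr
    _ = Real.log ((1 + 2 * (d : ℝ) / l) ^ l) := by rw [Real.log_pow]
    _ ≤ Real.log n := by
      refine Real.log_le_log (by positivity) ((one_add_div_pow_le_sum_choose hl hld).trans ?_)
      exact_mod_cast hlt.le

/-! ### Summation of the weights -/

/-- A partial sum form of `ζ(1 + δ) ≤ 1 + 1 / δ`. -/
theorem sum_rpow_neg_one_add_le {δ : ℝ} (hδ : 0 < δ) (N : ℕ) :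
    ∑ k ∈ Finset.range N, ((k : ℝ) + 1) ^ (-(1 + δ)) ≤ 1 + 1 / δ := by
  -- The subtracted term is the tail integral of `x^{-1-δ}` from `N + 1` to infinity. Retaining it
  -- makes the integral comparison an induction, with equality at `N = 0`.
  have key : ∀ N : ℕ, ∑ k ∈ Finset.range (N + 1), ((k : ℝ) + 1) ^ (-(1 + δ)) ≤
      1 + 1 / δ - ((N : ℝ) + 1) ^ (-δ) / δ := by
    intro N
    induction N with
    | zero => simp
    | succ N ih =>
      rw [Finset.sum_range_succ]
      push_cast
      have hN : (0 : ℝ) < (N : ℝ) + 1 := by positivity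
      set y : ℝ := (N : ℝ) + 1 + 1 with hy
      have hy0 : 0 < y := by positivity
      have h1 : ((N : ℝ) + 1) ^ (-δ) = ((N + 1) / y) ^ (-δ) * y ^ (-δ) := by
        rw [← Real.mul_rpow (by positivity) hy0.le, div_mul_cancel₀ _ hy0.ne']
      -- Bernoulli's inequality `(1 - 1/y)^{-δ} ≥ 1 + δ/y`, from `log x ≤ x - 1` and `e^x ≥ 1 + x`.
      have h2 : 1 + δ / y ≤ (((N : ℝ) + 1) / y) ^ (-δ) := by
        have hx : (0 : ℝ) < (N + 1) / y := by positivity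
        rw [Real.rpow_def_of_pos hx]
        have h3 := Real.log_le_sub_one_of_pos hx
        have h4 : ((N : ℝ) + 1) / y - 1 = - (1 / y) := by
          rw [hy]; field_simp; ring
        rw [h4] at h3
        have h5 := Real.add_one_le_exp (Real.log (((N : ℝ) + 1) / y) * -δ)
        have h6 : δ / y ≤ Real.log (((N : ℝ) + 1) / y) * -δ := by
          have := mul_le_mul_of_nonneg_right h3 hδ.le
          have h7 : δ / y = 1 / y * δ := by ring
          rw [h7]
          linarith
        linarith
      have h8 : y ^ (-(1 + δ)) = y ^ (-δ) / y := by
        rw [neg_add, add_comm, Real.rpow_add hy0, Real.rpow_neg_one, div_eq_mul_inv]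
      have h9 : y ^ (-δ) / y ≤ ((N : ℝ) + 1) ^ (-δ) / δ - y ^ (-δ) / δ := by
        have h10 : (1 + δ / y) * y ^ (-δ) ≤ ((N : ℝ) + 1) ^ (-δ) := by
          rw [h1]; gcongr
        rw [← sub_div, le_div_iff₀ hδ]
        have h11 : y ^ (-δ) / y * δ = (1 + δ / y) * y ^ (-δ) - y ^ (-δ) := by ring
        rw [h11]
        linarith
      rw [h8]
      linarith
  obtain _ | N := N
  · simp only [Finset.range_zero, Finset.sum_empty]
    positivity
  · refine (key N).trans ?_
    have : 0 ≤ ((N : ℝ) + 1) ^ (-δ) / δ := by positivity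
    linarith

/-- The values `u |k|`, `|k| ≤ N`, with those at `k ≠ 0` occurring twice. -/
theorem exists_symmetric_box (u : ℕ → ℝ) (N : ℕ) : ∃ T : Finset ℤ,
    (∀ k, k ∈ T ↔ k.natAbs ≤ N) ∧
    ∑ k ∈ T, u k.natAbs = u 0 + 2 * ∑ k ∈ Finset.range N, u (k + 1) := by
  induction N with
  | zero => exact ⟨{0}, by simp, by simp⟩
  | succ N ih =>
    obtain ⟨T, hT, hsum⟩ := ih
    refine ⟨insert ((N : ℤ) + 1) (insert (-((N : ℤ) + 1)) T), ?_, ?_⟩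
    · intro k
      rw [Finset.mem_insert, Finset.mem_insert, hT]
      omega
    · rw [Finset.sum_insert, Finset.sum_insert, hsum, Finset.sum_range_succ]
      · have h1 : ((N : ℤ) + 1).natAbs = N + 1 := by omega
        have h2 : (-((N : ℤ) + 1)).natAbs = N + 1 := by omega
        rw [h1, h2]
        ring
      · rw [hT]; omega
      · rw [Finset.mem_insert, hT]; omega

/-- Finite sums of a product of even functions over `ℤ^d` are bounded by an exponential. -/
theorem sum_prod_natAbs_le_exp {u : ℕ → ℝ} (hu : ∀ k, 0 ≤ u k) (hu0 : u 0 = 1) {Q : ℝ}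
    (hQ : ∀ N, 2 * ∑ k ∈ Finset.range N, u (k + 1) ≤ Q) {d : ℕ} (F : Finset (Fin d → ℤ)) :
    ∑ k ∈ F, ∏ j, u (k j).natAbs ≤ Real.exp (d * Q) := by
  classical
  -- `F` lies in the cube of side `{-N, …, N}`, over which the sum of products factors into a `d`-th
  -- power.
  let N : ℕ := F.sup fun k => Finset.univ.sup fun j => (k j).natAbs
  obtain ⟨T, hT, hsum⟩ := exists_symmetric_box u N
  have hF : F ⊆ Fintype.piFinset fun _ : Fin d => T := by
    intro k hk
    rw [Fintype.mem_piFinset]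
    intro j
    rw [hT]
    exact (Finset.le_sup (f := fun j => (k j).natAbs) (Finset.mem_univ j)).trans
      (Finset.le_sup (f := fun k : Fin d → ℤ => Finset.univ.sup fun j => (k j).natAbs) hk)
  have hQ0 : 0 ≤ Q := by simpa using hQ 0
  calc ∑ k ∈ F, ∏ j, u (k j).natAbs
      ≤ ∑ k ∈ Fintype.piFinset fun _ : Fin d => T, ∏ j, u (k j).natAbs :=
        Finset.sum_le_sum_of_subset_of_nonneg hF fun k _ _ => Finset.prod_nonneg fun j _ => hu _
    _ = (∑ k ∈ T, u k.natAbs) ^ d := by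
        rw [← Finset.prod_univ_sum (fun _ : Fin d => T) fun _ k => u k.natAbs]
        simp
    _ ≤ (Real.exp Q) ^ d := by
        refine pow_le_pow_left₀ (Finset.sum_nonneg fun _ _ => hu _) ?_ d
        rw [hsum, hu0]
        have := hQ N
        have := Real.add_one_le_exp Q
        linarith
    _ = Real.exp (d * Q) := by rw [← Real.exp_nat_mul]

/-- If `w_k ≥ (η k)^s` and `p = log d / log w_1 + (1 + δ) / s`, then
`2 ∑_{k ≥ 1} w_k^{-p} ≤ (3/η)^{1+δ} / (δ d)`. -/
theorem two_mul_sum_weight_rpow_le (w : FourierWeight) {s η δ : ℝ} (hs : 0 < s) (hη : 0 < η)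
    (hδ : 0 < δ) (hw1 : 1 < w.w 1) (hw : ∀ k : ℕ, (η * (k + 1)) ^ s ≤ w.w (k + 1))
    {d : ℕ} (hd : 1 ≤ d) (N : ℕ) :
    2 * ∑ k ∈ Finset.range N,
        w.w (k + 1) ^ (-(Real.log d / Real.log (w.w 1) + (1 + δ) / s)) ≤
      (3 / η) ^ (1 + δ) / δ / d := by
  have hΛ : 0 < Real.log (w.w 1) := Real.log_pos hw1
  have hd0 : (0 : ℝ) < d := by exact_mod_cast hd
  have hlogd : 0 ≤ Real.log d := Real.log_nonneg (by exact_mod_cast hd)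
  -- The two summands of the exponent act separately: `w_1^{-log d / log w_1} = 1/d`, and `(ηk)^s`
  -- raised to `-(1+δ)/s` is `(ηk)^{-(1+δ)}`.
  have hterm : ∀ k : ℕ, w.w (k + 1) ^ (-(Real.log d / Real.log (w.w 1) + (1 + δ) / s)) ≤
      (d : ℝ)⁻¹ * η ^ (-(1 + δ)) * ((k : ℝ) + 1) ^ (-(1 + δ)) := by
    intro k
    have hk0 : 0 < w.w (k + 1) := zero_lt_one.trans_le (w.one_le _)
    rw [neg_add, Real.rpow_add hk0]
    have h1 : w.w (k + 1) ^ (-(Real.log d / Real.log (w.w 1))) ≤ (d : ℝ)⁻¹ := by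
      calc w.w (k + 1) ^ (-(Real.log d / Real.log (w.w 1)))
          ≤ w.w 1 ^ (-(Real.log d / Real.log (w.w 1))) :=
            Real.rpow_le_rpow_of_nonpos (by linarith) (w.mono (by omega))
              (neg_nonpos.2 (by positivity))
        _ = (d : ℝ)⁻¹ := by
            rw [Real.rpow_def_of_pos (by linarith), mul_neg, mul_div_cancel₀ _ hΛ.ne',
              Real.exp_neg, Real.exp_log hd0]
    have h2 : w.w (k + 1) ^ (-((1 + δ) / s)) ≤ η ^ (-(1 + δ)) * ((k : ℝ) + 1) ^ (-(1 + δ)) := by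
      calc w.w (k + 1) ^ (-((1 + δ) / s)) ≤ ((η * (k + 1)) ^ s) ^ (-((1 + δ) / s)) :=
            Real.rpow_le_rpow_of_nonpos (by positivity) (hw k) (neg_nonpos.2 (by positivity))
        _ = η ^ (-(1 + δ)) * ((k : ℝ) + 1) ^ (-(1 + δ)) := by
            rw [← Real.rpow_mul (by positivity), mul_neg, mul_div_cancel₀ _ hs.ne',
              Real.mul_rpow hη.le (by positivity)]
    rw [mul_assoc]
    exact mul_le_mul h1 h2 (Real.rpow_nonneg hk0.le _) (by positivity)
  -- The origin of the `3` in `C̃`: Bernoulli gives `3^{1+δ} ≥ 3 + 2δ`, which absorbs the bound `2(δ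
  -- + 1)/δ` for `2ζ(1+δ)`.
  have h3 : 2 * (1 + 1 / δ) ≤ 3 ^ (1 + δ) / δ := by
    have := one_add_mul_self_le_rpow_one_add (s := 2) (by norm_num) (p := 1 + δ) (by linarith)
    norm_num at this
    rw [le_div_iff₀ hδ, mul_assoc, add_mul, one_div, inv_mul_cancel₀ hδ.ne']
    linarith
  calc 2 * ∑ k ∈ Finset.range N,
        w.w (k + 1) ^ (-(Real.log d / Real.log (w.w 1) + (1 + δ) / s))
      ≤ 2 * ∑ k ∈ Finset.range N,
        (d : ℝ)⁻¹ * η ^ (-(1 + δ)) * ((k : ℝ) + 1) ^ (-(1 + δ)) := by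
        gcongr with k _
        exact hterm k
    _ = (d : ℝ)⁻¹ * η ^ (-(1 + δ)) *
        (2 * ∑ k ∈ Finset.range N, ((k : ℝ) + 1) ^ (-(1 + δ))) := by
        rw [← Finset.mul_sum]; ring
    _ ≤ (d : ℝ)⁻¹ * η ^ (-(1 + δ)) * (3 ^ (1 + δ) / δ) := by
        gcongr
        exact (mul_le_mul_of_nonneg_left (sum_rpow_neg_one_add_le hδ N) zero_le_two).trans h3
    _ = (3 / η) ^ (1 + δ) / δ / d := by
        rw [Real.div_rpow (by norm_num) hη.le, Real.rpow_neg hη.le]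
        field_simp

/-! ### Bounds for the approximation numbers of tensor product embeddings -/

theorem approxNumber_mixEmbedding_le (P : TorusModel) (w : FourierWeight) {s η δ : ℝ}
    (hs : 0 < s) (hη : 0 < η) (hδ : 0 < δ) (hw1 : 1 < w.w 1)
    (hw : ∀ k : ℕ, (η * (k + 1)) ^ s ≤ w.w (k + 1)) {d n : ℕ} (hd : 1 ≤ d) (hn : 1 ≤ n) :
    approxNumber n (P.mixEmbedding w d) ≤ (tildeC η δ / n) ^
      (Real.log (w.w 1) / (Real.log d + (1 + δ) / s * Real.log (w.w 1))) := by
  classical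
  have hΛ : 0 < Real.log (w.w 1) := Real.log_pos hw1
  have hd0 : (0 : ℝ) < d := by exact_mod_cast hd
  have hn0 : (0 : ℝ) < n := by exact_mod_cast hn
  have hlogd : 0 ≤ Real.log d := Real.log_nonneg (by exact_mod_cast hd)
  set p : ℝ := Real.log d / Real.log (w.w 1) + (1 + δ) / s with hp
  have hp0 : 0 < p := by positivity
  have hα : Real.log (w.w 1) / (Real.log d + (1 + δ) / s * Real.log (w.w 1)) = p⁻¹ := by
    rw [hp, ← inv_div]
    congr 1
    field_simp
  have hC : 0 < tildeC η δ := Real.exp_pos _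
  rw [hα]
  set r : ℝ := (tildeC η δ / n) ^ p⁻¹ with hr
  have hr0 : 0 < r := by positivity
  have hW0 : ∀ k, 0 < (w.mix d).toFun k := fun k => zero_lt_one.trans_le ((w.mix d).one_le k)
  have hsum : ∀ F : Finset (Fin d → ℤ), ∑ k ∈ F, (w.mix d).toFun k ^ (-p) ≤ tildeC η δ := by
    intro F
    have h1 := sum_prod_natAbs_le_exp (u := fun k => w.w k ^ (-p))
      (fun k => Real.rpow_nonneg (zero_le_one.trans (w.one_le k)) _)
      (by simp only [w.zero, Real.one_rpow])
      (two_mul_sum_weight_rpow_le w hs hη hδ hw1 hw hd) F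
    rw [mul_div_cancel₀ _ hd0.ne'] at h1
    refine le_of_eq_of_le (Finset.sum_congr rfl fun k _ => ?_) h1
    change (∏ j, w.w (k j).natAbs) ^ (-p) = _
    rw [← Real.finsetProd_rpow _ _ fun j _ => zero_le_one.trans (w.one_le _)]
  -- Chebyshev's inequality: each such `k` contributes more than `C̃/n` to a sum bounded by `C̃`.
  have hcard : ∀ F : Finset (Fin d → ℤ), (∀ k ∈ F, r * (w.mix d).toFun k < 1) → F.card < n := by
    intro F hF
    rcases F.eq_empty_or_nonempty with rfl | hne
    · exact hn
    have h1 : ∀ k ∈ F, tildeC η δ / n < (w.mix d).toFun k ^ (-p) := by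
      intro k hk
      have h2 : r < ((w.mix d).toFun k)⁻¹ := by
        rw [← one_div, lt_div_iff₀ (hW0 k)]
        exact hF k hk
      have h3 := Real.rpow_lt_rpow hr0.le h2 hp0
      rw [hr, ← Real.rpow_mul (by positivity), inv_mul_cancel₀ hp0.ne', Real.rpow_one,
        Real.inv_rpow (hW0 k).le, ← Real.rpow_neg (hW0 k).le] at h3
      exact h3
    have h4 := (Finset.sum_lt_sum_of_nonempty hne h1).trans_le (hsum F)
    rw [Finset.sum_const, nsmul_eq_mul, ← mul_div_assoc, div_lt_iff₀ hn0,
      mul_comm (tildeC η δ)] at h4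
    exact_mod_cast lt_of_mul_lt_mul_right h4 hC.le
  -- An infinite set would contain `n` points, contradicting the bound for finite subsets.
  have hfin : {k | r * (w.mix d).toFun k < 1}.Finite := by
    by_contra hinf
    obtain ⟨t, ht, htn⟩ := Set.Infinite.exists_subset_card_eq hinf n
    exact absurd htn (hcard t fun k hk => ht hk).ne
  refine approxNumber_embedding_le _ _ hr0.le hfin.toFinset (hcard _ fun k hk => ?_) fun k hk => ?_
  · exact hfin.mem_toFinset.1 hk
  · exact not_lt.1 fun h => hk (hfin.mem_toFinset.2 h)

theorem le_approxNumber_mixEmbedding (P : TorusModel) (w : FourierWeight) (hw1 : 1 < w.w 1)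
    {d n : ℕ} (hn : 2 ≤ n) (hnd : n ≤ 3 ^ d) :
    (w.w 1)⁻¹ * (1 / (n : ℝ)) ^
        (Real.log (w.w 1) / Real.log (1 + 2 / Real.logb 3 n * d)) ≤
      approxNumber n (P.mixEmbedding w d) := by
  obtain ⟨l, hl, hle⟩ := exists_level hn hnd
  obtain ⟨S, hS, hmem⟩ := exists_finset_sign_vectors d (l + 1)
  have hw0 : 0 < w.w 1 := zero_lt_one.trans hw1
  have hΛ : 0 < Real.log (w.w 1) := Real.log_pos hw1
  have hn0 : (0 : ℝ) < n := by exact_mod_cast (by omega : 0 < n)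
  have h1 : (w.w 1)⁻¹ * (1 / (n : ℝ)) ^
        (Real.log (w.w 1) / Real.log (1 + 2 / Real.logb 3 n * d)) ≤ (w.w 1 ^ (l + 1))⁻¹ := by
    have h2 : (1 / (n : ℝ)) ^ (Real.log (w.w 1) / Real.log (1 + 2 / Real.logb 3 n * d)) ≤
        (w.w 1 ^ l)⁻¹ := by
      rw [← Real.exp_log (pow_pos hw0 l), ← Real.exp_neg, Real.log_pow,
        Real.rpow_def_of_pos (by positivity), one_div, Real.log_inv, Real.exp_le_exp,
        neg_mul, neg_le_neg_iff]
      calc (l : ℝ) * Real.log (w.w 1)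
          ≤ Real.log n / Real.log (1 + 2 / Real.logb 3 n * d) * Real.log (w.w 1) := by gcongr
        _ = _ := by ring
    rw [pow_succ', mul_inv]
    gcongr
  refine h1.trans (le_approxNumber_embedding _ _ (by omega) (by positivity) S (hl.trans hS) ?_)
  intro k hk
  obtain ⟨t, ht, hkt⟩ := hmem k hk
  rw [inv_mul_le_iff₀ (by positivity), mul_one]
  change ∏ j, w.w (k j).natAbs ≤ _
  calc ∏ j, w.w (k j).natAbs = ∏ j, if j ∈ t then w.w 1 else 1 := by
        refine Finset.prod_congr rfl fun j _ => ?_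
        split_ifs with hj
        · rw [(hkt j).1 hj]
        · rw [(hkt j).2 hj, Int.natAbs_zero, w.zero]
    _ = w.w 1 ^ t.card := by simp
    _ ≤ w.w 1 ^ (l + 1) := pow_le_pow_right₀ hw1.le ht

/-! ### The four Sobolev norms -/

/-- Dropping the other nonnegative terms inside each weight leaves `t^s`. For `∘` this is the term
`l = ⌊s⌋`, which equals `t^{2s}` because `s` is an integer. -/
theorem NormKind.rpow_le_weightAt (kind : NormKind) {s t : ℝ} (hs : 0 < s)
    (hcirc : kind = NormKind.circ → ∃ m : ℕ, s = m) (ht : 0 ≤ t) :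
    t ^ s ≤ kind.weightAt s t := by
  have hsq : (t ^ (2 * s)) ^ (1 / 2 : ℝ) = t ^ s := by
    rw [← Real.rpow_mul ht]
    congr 1
    ring
  cases kind with
  | circ =>
    obtain ⟨m, rfl⟩ := hcirc rfl
    rw [weightAt, abs_of_nonneg ht, Nat.floor_natCast, ← hsq]
    refine Real.rpow_le_rpow (by positivity) ?_ (by norm_num)
    have h1 : t ^ (2 * (m : ℝ)) = t ^ (2 * m) := by exact_mod_cast Real.rpow_natCast t (2 * m)
    rw [h1]
    exact Finset.single_le_sum (f := fun l => t ^ (2 * l)) (fun _ _ => by positivity)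
      (Finset.mem_range.2 (Nat.lt_succ_self m))
  | star =>
    rw [weightAt, abs_of_nonneg ht, ← hsq]
    refine Real.rpow_le_rpow (by positivity) ?_ (by norm_num)
    linarith
  | plus =>
    have h1 : t ^ s = (t ^ 2) ^ (s / 2) := by
      rw [← Real.rpow_natCast, ← Real.rpow_mul ht]
      congr 1
      push_cast
      ring
    rw [weightAt, abs_of_nonneg ht, h1]
    refine Real.rpow_le_rpow (by positivity) ?_ (by positivity)
    linarith
  | sharp =>
    rw [weightAt, abs_of_nonneg ht]
    exact Real.rpow_le_rpow ht (by linarith) hs.le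

theorem NormKind.one_lt_weightAt (kind : NormKind) {s t : ℝ} (hs : 0 < s)
    (hcirc : kind = NormKind.circ → ∃ m : ℕ, s = m) (ht : 0 < t) :
    1 < kind.weightAt s t := by
  cases kind with
  | circ =>
    obtain ⟨m, rfl⟩ := hcirc rfl
    have hm : 0 < m := by exact_mod_cast hs
    rw [weightAt, abs_of_pos ht, Nat.floor_natCast]
    refine Real.one_lt_rpow ?_ (by norm_num)
    rw [Finset.sum_range_succ']
    have h1 : 0 < ∑ l ∈ Finset.range m, t ^ (2 * (l + 1)) :=
      Finset.sum_pos (fun _ _ => by positivity) ⟨0, Finset.mem_range.2 hm⟩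
    simpa using h1
  | star =>
    rw [weightAt, abs_of_pos ht]
    exact Real.one_lt_rpow (lt_add_of_pos_right _ (by positivity)) (by norm_num)
  | plus =>
    rw [weightAt, abs_of_pos ht]
    exact Real.one_lt_rpow (lt_add_of_pos_right _ (by positivity)) (by positivity)
  | sharp =>
    rw [weightAt, abs_of_pos ht]
    exact Real.one_lt_rpow (lt_add_of_pos_right _ ht) hs

theorem NormKind.sum_pos {η : ℝ} (hη : 0 < η) (m : ℕ) :
    0 < ∑ l ∈ Finset.range (m + 1), η ^ (2 * l) :=
  Finset.sum_pos (fun _ _ => by positivity) ⟨0, by simp⟩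

/-- This and the next two lemmas write all four table rows uniformly in terms of `w_1 = weightAt s
η`; the row-dependent factors `1/2`, `s/2`, `s` are the outer exponents of the weight. -/
theorem NormKind.sigmaTwo_eq (kind : NormKind) {s η : ℝ} (hη : 0 < η) :
    kind.sigmaTwo s η = (kind.weightAt s η)⁻¹ := by
  cases kind with
  | circ => rw [sigmaTwo, weightAt, abs_of_pos hη, Real.rpow_neg (sum_pos hη _).le]
  | star => rw [sigmaTwo, weightAt, abs_of_pos hη, Real.rpow_neg (by positivity)]
  | plus => rw [sigmaTwo, weightAt, abs_of_pos hη, Real.rpow_neg (by positivity)]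
  | sharp => rw [sigmaTwo, weightAt, abs_of_pos hη, Real.rpow_neg (by positivity)]

theorem NormKind.beta_eq (kind : NormKind) {s η : ℝ} (hη : 0 < η) (d n : ℕ) :
    kind.beta s η d n =
      Real.log (kind.weightAt s η) / Real.log (1 + 2 / Real.logb 3 n * d) := by
  cases kind with
  | circ => rw [beta, weightAt, abs_of_pos hη, Real.log_rpow (sum_pos hη _)]
  | star => rw [beta, weightAt, abs_of_pos hη, Real.log_rpow (by positivity)]
  | plus => rw [beta, weightAt, abs_of_pos hη, Real.log_rpow (by positivity)]
  | sharp => rw [beta, weightAt, abs_of_pos hη, Real.log_rpow (by positivity)]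

theorem NormKind.alpha_eq (kind : NormKind) {s η : ℝ} (hs : 0 < s) (hη : 0 < η) (d : ℕ) (δ : ℝ) :
    kind.alpha s η d δ = Real.log (kind.weightAt s η) /
      (Real.log d + (1 + δ) / s * Real.log (kind.weightAt s η)) := by
  cases kind with
  | circ =>
    rw [alpha, weightAt, abs_of_pos hη, Real.log_rpow (sum_pos hη _)]
    congr 2
    field_simp
  | star =>
    rw [alpha, weightAt, abs_of_pos hη, Real.log_rpow (by positivity)]
    congr 2
    field_simp
  | plus =>
    rw [alpha, weightAt, abs_of_pos hη, Real.log_rpow (by positivity)]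
    congr 2
    field_simp
  | sharp =>
    rw [alpha, weightAt, abs_of_pos hη, Real.log_rpow (by positivity)]
    congr 2
    field_simp

theorem eta_pos (P : TorusModel) {γ : ℝ} (hγ : 0 < γ) : 0 < eta P γ :=
  div_pos Real.two_pi_pos (mul_pos hγ (sub_pos.2 P.a_lt_b))

theorem sobolevWeight_apply (P : TorusModel) (kind : NormKind) {s : ℝ} (hs : 0 < s) (γ : ℝ)
    (k : ℕ) : (sobolevWeight P kind hs γ).w k = kind.weightAt s (eta P γ * k) := by
  change kind.weightAt s _ = _
  congr 1
  rw [eta, ← div_div]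
  ring

end TorusApprox

/-! ### The two-sided estimate for the four norms -/

theorem mainTheorem10 (P : TorusApprox.TorusModel) (kind : TorusApprox.NormKind)
    (s γ : ℝ) (hs : 0 < s) (hγ : 0 < γ)
    (hcirc : kind = TorusApprox.NormKind.circ → ∃ m : ℕ, s = m)
    (d : ℕ) (hd : 1 ≤ d) :
    (∀ n : ℕ, 2 ≤ n → n ≤ 3 ^ d →
      kind.sigmaTwo s (TorusApprox.eta P γ) *
          (1 / (n : ℝ)) ^ kind.beta s (TorusApprox.eta P γ) d n ≤
        TorusApprox.mixApproxNumber P kind hs γ d n) ∧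
    (∀ δ : ℝ, 0 < δ → δ ≤ 1 → ∀ n : ℕ, 1 ≤ n →
      TorusApprox.mixApproxNumber P kind hs γ d n ≤
        (TorusApprox.tildeC (TorusApprox.eta P γ) δ / (n : ℝ)) ^
          kind.alpha s (TorusApprox.eta P γ) d δ) := by
  have hη := TorusApprox.eta_pos P hγ
  have hw_one : (TorusApprox.sobolevWeight P kind hs γ).w 1 =
      kind.weightAt s (TorusApprox.eta P γ) := by
    rw [TorusApprox.sobolevWeight_apply, Nat.cast_one, mul_one]
  have hw1 : 1 < (TorusApprox.sobolevWeight P kind hs γ).w 1 := by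
    rw [hw_one]
    exact kind.one_lt_weightAt hs hcirc hη
  refine ⟨fun n hn hnd => ?_, fun δ hδ _ n hn => ?_⟩
  · rw [kind.sigmaTwo_eq hη, kind.beta_eq hη, ← hw_one]
    exact TorusApprox.le_approxNumber_mixEmbedding P _ hw1 hn hnd
  · rw [kind.alpha_eq hs hη, ← hw_one]
    refine TorusApprox.approxNumber_mixEmbedding_le P _ hs hη hδ hw1 (fun k => ?_) hd hn
    rw [TorusApprox.sobolevWeight_apply, Nat.cast_add_one]
    exact kind.rpow_le_weightAt hs hcirc (by positivity)
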